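/- Conventions. A problem is a partial multifunction $f :\subseteq \mathbb{N}^{\mathbb{N}} \rightrightarrows \mathbb{N}^{\mathbb{N}}$; other inputs and outputs (numbers, colourings, intervals, tuples) are represented by elements of $\mathbb{N}^{\mathbb{N}}$ in the usual effective way. A realizer of $f$ is a partial function $F$ on $\mathbb{N}^{\mathbb{N}}$ with $F(x) \in f(x)$ for all $x \in \mathrm{dom}(f)$. We write $g \le_{\mathrm W} f$ if there are computable (partial) functionals $H, K$ such that $x \mapsto K\langle F(H(x)), x\rangle$ is a realizer of $g$ whenever $F$ is a realizer of $f$, and $f \equiv_{\mathrm W} g$ if $f \le_{\mathrm W} g$ and $g \le_{\mathrm W} f$. For $m \in \mathbb{N}$, $f^m$ is the $m$-fold parallel product (solve $m$ given instances of $f$), $f^0$ being the trivial problem with one instance and one solution; $f^*$ is the finite parallelization (given $m \in \mathbb{N}$ and an instance of $f^m$, return $m$ and a solution of that instance). A number $n$ is identified with $\{0,\dots,n-1\}$. * $\mathsf{TC}_{\mathbb{N}}$: given an enumeration of an arbitrary set $A \subseteq \mathbb{N}$ (possibly empty, possibly $\mathbb{N}$), find $a \in \mathbb{N}$ such that $a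 \notin A$ or $A = \mathbb{N}$. * $\mathsf{ECT}$: given $(n, f)$ with $n \in \mathbb{N}$ and $f : \mathbb{N} \to n$, find $b \in \mathbb{N}$ such that $\forall x > b\ \exists y > x\ f(x) = f(y)$. * $\mathsf{iShuffle}$: given $(n, c)$ with $n \in \mathbb{N}$ and $c : \mathbb{Q} \to n$, find rationals $u < v$ such that $]u,v[$ is a $c$-shuffle, i.e. the set of rationals in $]u,v[$ has a finite partition into subsets, each dense in $]u,v[$, on each of which $c$ is constant. * $\mathsf{ECT}_n$ and $\mathsf{iShuffle}_n$ are the restrictions of $\mathsf{ECT}$ and $\mathsf{iShuffle}$ to the instances whose first component is $n$. Theorem. For every $n \ge 1$, $$\mathsf{ECT}_n \equiv_{\mathrm W} \mathsf{iShuffle}_n \equiv_{\mathrm W} \mathsf{TC}_{\mathbb{N}}^{\,n-1}.$$ Moreover $$\mathsf{ECT} \equiv_{\mathrm W} \mathsf{iShuffle} \equiv_{\mathrm W} \mathsf{TC}_{\mathbb{N}}^{*}.$$ -/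

import Mathlib

namespace Weihrauch

/-! ### Computable functionals on Baire space -/

/-- The partial recursive functionals `Φ(p, n)`, with a function argument `p : ℕ → ℕ` (the oracle)
and a number argument `n`: Kleene's schemes, uniform in `p`, plus the evaluation scheme
`(p, n) ↦ p n`. -/
inductive OracleRec : ((ℕ → ℕ) → ℕ →. ℕ) → Prop
  | zero : OracleRec fun _ _ => Part.some 0
  | succ : OracleRec fun _ n => Part.some (n + 1)
  | left : OracleRec fun _ n => Part.some n.unpair.1
  | right : OracleRec fun _ n => Part.some n.unpair.2
  | oracle : OracleRec fun p n => Part.some (p n)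
  | pair {Φ Ψ : (ℕ → ℕ) → ℕ →. ℕ} (hΦ : OracleRec Φ) (hΨ : OracleRec Ψ) :
      OracleRec fun p n => (Φ p n).bind fun a => (Ψ p n).bind fun b => Part.some (Nat.pair a b)
  | comp {Φ Ψ : (ℕ → ℕ) → ℕ →. ℕ} (hΦ : OracleRec Φ) (hΨ : OracleRec Ψ) :
      OracleRec fun p n => (Ψ p n).bind (Φ p)
  | prec {Φ Ψ : (ℕ → ℕ) → ℕ →. ℕ} (hΦ : OracleRec Φ) (hΨ : OracleRec Ψ) :
      OracleRec fun p n =>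
        n.unpair.2.rec (Φ p n.unpair.1) fun y IH =>
          IH.bind fun i => Ψ p (Nat.pair n.unpair.1 (Nat.pair y i))
  | rfind {Φ : (ℕ → ℕ) → ℕ →. ℕ} (hΦ : OracleRec Φ) :
      OracleRec fun p a => Nat.rfind fun n => (Φ p (Nat.pair a n)).map fun m => decide (m = 0)

/-- A partial function on Baire space is computable if some partial recursive functional
computes, uniformly in `p` in its domain, the values of the function `F(p)`. -/
def ComputableFunctional (F : (ℕ → ℕ) →. (ℕ → ℕ)) : Prop :=
  ∃ Φ, OracleRec Φ ∧ ∀ p, ∀ q ∈ F p, ∀ n, q n ∈ Φ p n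

/-- The pairing `⟨p, q⟩` of Baire space: `p` on the even places, `q` on the odd ones. -/
def bairePair (p q : ℕ → ℕ) : ℕ → ℕ :=
  fun n => if n % 2 = 0 then p (n / 2) else q (n / 2)

/-! ### Problems and Weihrauch reducibility -/

/-- A problem: a partial multifunction on Baire space. Every point of the domain has at least one
value; the values `sol p` for `p ∉ dom` are irrelevant. -/
structure Problem where
  dom : Set (ℕ → ℕ)
  sol : (ℕ → ℕ) → Set (ℕ → ℕ)
  nonempty : ∀ p ∈ dom, (sol p).Nonempty

/-- `F` is a realizer of `f`: on `dom f` it is defined and picks a solution. -/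
def Realizes (F : (ℕ → ℕ) →. (ℕ → ℕ)) (f : Problem) : Prop :=
  ∀ p ∈ f.dom, ∃ q ∈ F p, q ∈ f.sol p

/-- Weihrauch reducibility `g ≤_W f`: there are computable functionals `H` and `K` such that
`p ↦ K ⟨F (H p), p⟩` realizes `g` whenever `F` realizes `f`. -/
def Reducible (g f : Problem) : Prop :=
  ∃ H K : (ℕ → ℕ) →. (ℕ → ℕ), ComputableFunctional H ∧ ComputableFunctional K ∧
    ∀ F : (ℕ → ℕ) →. (ℕ → ℕ), Realizes F f →
      Realizes (fun p => (H p).bind fun r => (F r).bind fun s => K (bairePair s p)) g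

/-- Weihrauch equivalence `f ≡_W g`. -/
def Equivalent (f g : Problem) : Prop := Reducible f g ∧ Reducible g f

/-- The sequence `p` without its first entry. -/
def tail (p : ℕ → ℕ) : ℕ → ℕ := fun i => p (i + 1)

/-- The `j`-th of the countably many sequences coded by `p`. -/
def row (p : ℕ → ℕ) (j : ℕ) : ℕ → ℕ := fun i => p (Nat.pair j i)

/-- The `m`-fold parallel product `f ^ m = f × ⋯ × f`. For `m = 0` it is the trivial problem, with
exactly one instance and one solution (of which every sequence is a name). -/
def Problem.power (f : Problem) (m : ℕ) : Problem where
  dom := {p | ∀ j < m, row p j ∈ f.dom}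
  sol p := {q | ∀ j < m, row q j ∈ f.sol (row p j)}
  nonempty p hp := by
    choose! s hs using f.nonempty
    refine ⟨fun n => s (row p n.unpair.1) n.unpair.2, fun j hj => ?_⟩
    have h := hs _ (hp j hj)
    have e : row (fun n => s (row p n.unpair.1) n.unpair.2) j = s (row p j) := by
      funext i; simp [row]
    rwa [← e] at h

/-- The finite parallelization `f^*`: an instance is a number `m` with an instance of `f ^ m`, a
solution is `m` with a solution of that instance of `f ^ m`. -/
def Problem.finPar (f : Problem) : Problem where
  dom := {p | tail p ∈ (f.power (p 0)).dom}
  sol p := {q | q 0 = p 0 ∧ tail q ∈ (f.power (p 0)).sol (tail p)}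
  nonempty p hp := by
    obtain ⟨q, hq⟩ := (f.power (p 0)).nonempty _ hp
    exact ⟨fun i => if i = 0 then p 0 else q (i - 1), if_pos rfl, hq⟩

/-- The restriction of a problem with instances of the form `(n, x)` to those with the given
number `n`, where `n` is the first entry of the name of the instance. -/
def Problem.withFirst (f : Problem) (n : ℕ) : Problem where
  dom := {p | p ∈ f.dom ∧ p 0 = n}
  sol := f.sol
  nonempty p hp := f.nonempty p hp.1

/-! ### The problem `TC_ℕ` -/

/-- The set enumerated by `e`: the entry `a + 1` enumerates `a`, the entry `0` enumerates nothing
(so that the empty set has an enumeration too). -/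
def enumerated (e : ℕ → ℕ) : Set ℕ := {a | ∃ i, e i = a + 1}

/-- Totalized closed choice on `ℕ`: given an enumeration of any set `A ⊆ ℕ`, find a number `a`
with `a ∉ A`, or any number at all if `A = ℕ`. The solution is `a = q 0`. -/
def TCN : Problem where
  dom := Set.univ
  sol e := {q | q 0 ∉ enumerated e ∨ enumerated e = Set.univ}
  nonempty e _ := by
    by_cases h : enumerated e = Set.univ
    · exact ⟨fun _ => 0, Or.inr h⟩
    · obtain ⟨a, ha⟩ := (Set.ne_univ_iff_exists_notMem _).1 h
      exact ⟨fun _ => a, Or.inl ha⟩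

/-! ### The problem `ECT` -/

/-- `b` is a bound for `f`: after `b` the palette of colours of `f` is constant. -/
def IsBound (f : ℕ → ℕ) (b : ℕ) : Prop := ∀ x > b, ∃ y > x, f x = f y

theorem exists_isBound {n : ℕ} {f : ℕ → ℕ} (hf : ∀ x, f x < n) : ∃ b, IsBound f b := by
  by_contra! h
  have hinf : {x | ∀ y > x, f x ≠ f y}.Infinite := by
    refine Set.infinite_of_forall_exists_gt fun b => ?_
    have hb := h b
    simp only [IsBound, not_forall, not_exists, not_and] at hb
    obtain ⟨x, hx, hy⟩ := hb
    exact ⟨x, hy, hx⟩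
  refine Set.not_injOn_infinite_finite_image hinf
    ((Set.finite_Iio n).subset (by rintro _ ⟨x, _, rfl⟩; exact hf x)) ?_
  intro x hx y hy hxy
  rcases lt_trichotomy x y with hlt | heq | hlt
  · exact absurd hxy (hx y hlt)
  · exact heq
  · exact absurd hxy.symm (hy x hlt)

/-- `ECT`: an instance is `(n, f)` with `f : ℕ → n` a colouring of the natural numbers (`n = p 0`
and `f = tail p`), a solution is a bound `b = q 0` for `f`. -/
def ECT : Problem where
  dom := {p | ∀ x, tail p x < p 0}
  sol p := {q | IsBound (tail p) (q 0)}
  nonempty _ hp := by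
    obtain ⟨b, hb⟩ := exists_isBound hp
    exact ⟨fun _ => b, hb⟩

/-! ### The problem `iShuffle` -/

/-- The numbering of the rationals in which `⟨⟨a, b⟩, d⟩` codes `(a - b) / (d + 1)`. -/
def ratOfCode (i : ℕ) : ℚ :=
  ((i.unpair.1.unpair.1 : ℚ) - i.unpair.1.unpair.2) / (i.unpair.2 + 1)

theorem ratOfCode_surjective : Function.Surjective ratOfCode := by
  intro x
  refine ⟨Nat.pair (Nat.pair x.num.toNat (-x.num).toNat) (x.den - 1), ?_⟩
  have h1 : ((x.num.toNat : ℚ) - ((-x.num).toNat : ℚ)) = (x.num : ℚ) := by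
    have : ((x.num.toNat : ℤ) - ((-x.num).toNat : ℤ)) = x.num := by omega
    exact_mod_cast this
  have h2 : (((x.den - 1 : ℕ) : ℚ) + 1) = (x.den : ℚ) := by
    have := x.den_pos
    have : x.den - 1 + 1 = x.den := by omega
    exact_mod_cast this
  simp only [ratOfCode, Nat.unpair_pair, h1, h2]
  exact Rat.num_div_den x

/-- The interval `]u, v[` of rationals is a `c`-shuffle: it has a finite partition into dense
subsets on each of which `c` is constant. -/
def IsShuffle (c : ℚ → ℕ) (u v : ℚ) : Prop :=
  ∃ (m : ℕ) (D : Fin m → Set ℚ),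
    (⋃ i, D i) = Set.Ioo u v ∧ Pairwise (fun i j => Disjoint (D i) (D j)) ∧
    ∀ i, (∀ x ∈ Set.Ioo u v, ∀ y ∈ Set.Ioo u v, x < y → ∃ z ∈ D i, x < z ∧ z < y) ∧
      ∀ z ∈ D i, ∀ w ∈ D i, c z = c w

theorem exists_isShuffle {k : ℕ} {c : ℚ → ℕ} (hc : ∀ x, c x < k) :
    ∃ u v, u < v ∧ IsShuffle c u v := by
  have hfin (u v : ℚ) : (c '' Set.Ioo u v).Finite :=
    (Set.finite_Iio k).subset (by rintro _ ⟨x, _, rfl⟩; exact hc x)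
  have hex : ∃ n u v, u < v ∧ (c '' Set.Ioo u v).ncard = n := ⟨_, 0, 1, by norm_num, rfl⟩
  classical
  obtain ⟨u, v, huv, hn⟩ := Nat.find_spec hex
  have hmin : ∀ x y, u ≤ x → y ≤ v → x < y → c '' Set.Ioo x y = c '' Set.Ioo u v := by
    intro x y hx hy hxy
    refine Set.eq_of_subset_of_ncard_le (Set.image_mono (Set.Ioo_subset_Ioo hx hy)) ?_ (hfin u v)
    rw [hn]
    exact Nat.find_min' hex ⟨x, y, hxy, rfl⟩
  have : Finite (c '' Set.Ioo u v) := hfin u v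
  obtain ⟨m, ⟨e⟩⟩ := Finite.exists_equiv_fin (c '' Set.Ioo u v)
  refine ⟨u, v, huv, m, fun i => {x | x ∈ Set.Ioo u v ∧ c x = (e.symm i : ℕ)}, ?_, ?_, ?_⟩
  · ext x
    rw [Set.mem_iUnion]
    exact ⟨fun ⟨_, h, _⟩ => h,
      fun h => ⟨e ⟨c x, Set.mem_image_of_mem c h⟩, h, by simp⟩⟩
  · intro i j hij
    refine Set.disjoint_left.2 fun x hx hy => hij ?_
    exact e.symm.injective (Subtype.ext (hx.2.symm.trans hy.2))
  · refine fun i => ⟨fun x hx y hy hxy => ?_, fun z hz w hw => hz.2.trans hw.2.symm⟩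
    have h : (e.symm i : ℕ) ∈ c '' Set.Ioo x y := by
      rw [hmin x y hx.1.le hy.2.le hxy]
      exact (e.symm i).2
    obtain ⟨z, hz, hcz⟩ := h
    exact ⟨z, ⟨⟨hx.1.trans hz.1, hz.2.trans hy.2⟩, hcz⟩, hz.1, hz.2⟩

/-- `p` is a name of the pair `(k, c)` with `c : ℚ → k` a colouring of the rationals. -/
def NamesColouring (p : ℕ → ℕ) (c : ℚ → ℕ) : Prop :=
  (∀ x, c x < p 0) ∧ ∀ i, tail p i = c (ratOfCode i)

/-- `iShuffle`: an instance is `(k, c)` with `c : ℚ → k` a colouring of the rationals, a solution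
is an interval `]u, v[`, given by codes of `u < v`, that is a `c`-shuffle. -/
def iShuffle : Problem where
  dom := {p | ∃ c, NamesColouring p c}
  sol p := {q | ratOfCode (q 0) < ratOfCode (q 1) ∧
    ∃ c, NamesColouring p c ∧ IsShuffle c (ratOfCode (q 0)) (ratOfCode (q 1))}
  nonempty p hp := by
    obtain ⟨c, hc⟩ := hp
    obtain ⟨u, v, huv, h⟩ := exists_isShuffle hc.1
    obtain ⟨i, rfl⟩ := ratOfCode_surjective u
    obtain ⟨j, rfl⟩ := ratOfCode_surjective v
    exact ⟨fun n => if n = 0 then i else j, by simpa using huv, c, hc, by simpa using h⟩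

end Weihrauch

namespace Weihrauch

open Encodable

/-! All reductions rest on counters that move exactly when an event happens. A bound for a colouring
that records the events is a time after which each kind of event happens never or infinitely often,
and both outcomes are useful.

From `ECT` to choice (`isBound_of_choice`): let `r` be the number of recurring colours. If `r = n`,
every number is a bound. Otherwise a number followed by at most `r` colours is a bound, and choice
row `r - 1` finds one. As `r` is unknown, the `n - 1` answers are added up.

From choice to `ECT` (`candidate_spec`): each row keeps a candidate and increases it when it turns
out to be enumerated. With `m` rows this gives `m` kinds of events and one default colour. After the
bound a candidate is either final, hence correct, or increased forever, and then the row enumerates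
all of `ℕ`.

From `ECT` to `iShuffle` (`isBound_of_isShuffle`): a rational is coloured by the colour of its
level. An interval contains all sufficiently large levels, and close to a rational all other levels
are larger, so in a shuffle every such colour recurs.

From `iShuffle` to `ECT` (`isShuffle_trialInterval`): nested intervals are searched for one with few
colours, the `k`-th being given up when `n - k` colours are seen in it. After a bound, let `K < n -
1` be the first stage given up infinitely often, or `K = n - 1`. The interval before stage `K` is
fixed and has at most `n - K` colours, while each of its subintervals has at least that many. So it
is a shuffle, and so is the innermost interval, which can be returned without knowing `K`. -/

theorem OracleRec.of_partrec {f : ℕ →. ℕ} (hf : Nat.Partrec f) : OracleRec fun _ n => f n := by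
  induction hf with
  | zero => exact .zero
  | succ => exact .succ
  | left => exact .left
  | right => exact .right
  | pair _ _ hf hg =>
    convert OracleRec.pair hf hg using 3
    simp [Seq.seq, Part.map_eq_map, Part.bind_some_eq_map, Part.bind_map]
  | comp _ _ hf hg => exact .comp hf hg
  | prec _ _ hf hg => exact .prec hf hg
  | rfind _ hf => exact .rfind hf

/-- Substituting a functional for the oracle. -/
theorem OracleRec.subst {Φ Ψ : (ℕ → ℕ) → ℕ →. ℕ} (hΦ : OracleRec Φ) (hΨ : OracleRec Ψ) :
    ∃ Θ, OracleRec Θ ∧ ∀ p q, (∀ n, Ψ p n = Part.some (q n)) → Θ p = Φ q := by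
  induction hΦ with
  | zero => exact ⟨_, .zero, fun _ _ _ => rfl⟩
  | succ => exact ⟨_, .succ, fun _ _ _ => rfl⟩
  | left => exact ⟨_, .left, fun _ _ _ => rfl⟩
  | right => exact ⟨_, .right, fun _ _ _ => rfl⟩
  | oracle => exact ⟨_, hΨ, fun p q h => funext h⟩
  | pair _ _ ih₁ ih₂ =>
    obtain ⟨Θ₁, h₁, e₁⟩ := ih₁
    obtain ⟨Θ₂, h₂, e₂⟩ := ih₂
    exact ⟨_, .pair h₁ h₂, fun p q h => by simp only [e₁ p q h, e₂ p q h]; rfl⟩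
  | comp _ _ ih₁ ih₂ =>
    obtain ⟨Θ₁, h₁, e₁⟩ := ih₁
    obtain ⟨Θ₂, h₂, e₂⟩ := ih₂
    exact ⟨_, .comp h₁ h₂, fun p q h => by simp only [e₁ p q h, e₂ p q h]; rfl⟩
  | prec _ _ ih₁ ih₂ =>
    obtain ⟨Θ₁, h₁, e₁⟩ := ih₁
    obtain ⟨Θ₂, h₂, e₂⟩ := ih₂
    exact ⟨_, .prec h₁ h₂, fun p q h => by simp only [e₁ p q h, e₂ p q h]; rfl⟩
  | rfind _ ih =>
    obtain ⟨Θ, h₁, e⟩ := ih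
    exact ⟨_, .rfind h₁, fun p q h => by simp only [e p q h]; rfl⟩

/-! ### A calculus of total functionals computable in an oracle. -/

section OracleComputable

variable {α β γ σ : Type*} [Primcodable α] [Primcodable β] [Primcodable γ] [Primcodable σ]

/-- A total functional with a function argument and an argument from a coded type is computable. -/
def OracleComputable (f : (ℕ → ℕ) → α → β) : Prop :=
  ∃ Φ, OracleRec Φ ∧ ∀ p a, Φ p (encode a) = Part.some (encode (f p a))

namespace OracleComputable

theorem of_computable {f : α → β} (hf : Computable f) :
    OracleComputable fun _ => f :=
  ⟨_, .of_partrec hf, fun _ a => by simp⟩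

theorem const (b : β) : OracleComputable fun _ (_ : α) => b := of_computable (.const b)

theorem id : OracleComputable fun _ (a : α) => a := of_computable .id

theorem fst : OracleComputable fun _ (a : α × β) => a.1 := of_computable .fst

theorem snd : OracleComputable fun _ (a : α × β) => a.2 := of_computable .snd

theorem comp {f : (ℕ → ℕ) → β → γ} {g : (ℕ → ℕ) → α → β} (hf : OracleComputable f)
    (hg : OracleComputable g) : OracleComputable fun p a => f p (g p a) := by
  obtain ⟨Φ, hΦ, eΦ⟩ := hf
  obtain ⟨Ψ, hΨ, eΨ⟩ := hg
  exact ⟨_, .comp hΦ hΨ, fun p a => by simp only [eΨ]; exact (Part.bind_some _ _).trans (eΦ p _)⟩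

theorem pair {f : (ℕ → ℕ) → α → β} {g : (ℕ → ℕ) → α → γ} (hf : OracleComputable f)
    (hg : OracleComputable g) : OracleComputable fun p a => (f p a, g p a) := by
  obtain ⟨Φ, hΦ, eΦ⟩ := hf
  obtain ⟨Ψ, hΨ, eΨ⟩ := hg
  exact ⟨_, .pair hΦ hΨ, fun p a => by simp [eΦ, eΨ]⟩

theorem map {f : β → γ} {g : (ℕ → ℕ) → α → β} (hf : Computable f) (hg : OracleComputable g) :
    OracleComputable fun p a => f (g p a) := (of_computable hf).comp hg

theorem map₂ {f : β → γ → σ} {g : (ℕ → ℕ) → α → β} {h : (ℕ → ℕ) → α → γ} (hf : Computable₂ f)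
    (hg : OracleComputable g) (hh : OracleComputable h) :
    OracleComputable fun p a => f (g p a) (h p a) :=
  (of_computable (f := fun x : β × γ => f x.1 x.2) hf).comp (hg.pair hh)

theorem apply {f : (ℕ → ℕ) → α → ℕ} (hf : OracleComputable f) :
    OracleComputable fun p a => p (f p a) := by
  have : OracleComputable fun p (n : ℕ) => p n := ⟨_, .oracle, fun p a => by simp⟩
  exact this.comp hf

theorem subst {f : (ℕ → ℕ) → α → β} {x : (ℕ → ℕ) → ℕ → ℕ} (hf : OracleComputable f)
    (hx : OracleComputable x) : OracleComputable fun p a => f (x p) a := by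
  obtain ⟨Φ, hΦ, eΦ⟩ := hf
  obtain ⟨Ψ, hΨ, eΨ⟩ := hx
  obtain ⟨Θ, hΘ, eΘ⟩ := hΦ.subst hΨ
  exact ⟨Θ, hΘ, fun p a => by rw [eΘ p (x p) (by simpa using eΨ p), eΦ]⟩

theorem nat_rec {f : (ℕ → ℕ) → α → ℕ} {g : (ℕ → ℕ) → α → σ} {h : (ℕ → ℕ) → α × ℕ × σ → σ}
    (hf : OracleComputable f) (hg : OracleComputable g) (hh : OracleComputable h) :
    OracleComputable fun p a => Nat.rec (motive := fun _ => σ) (g p a)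
      (fun y s => h p (a, y, s)) (f p a) := by
  obtain ⟨Φ, hΦ, eΦ⟩ := hg
  obtain ⟨Ψ, hΨ, eΨ⟩ := hh
  have key : OracleComputable fun p (a : α × ℕ) => Nat.rec (motive := fun _ => σ) (g p a.1)
      (fun y s => h p (a.1, y, s)) a.2 := by
    refine ⟨_, .prec hΦ hΨ, fun p ⟨a, n⟩ => ?_⟩
    simp only [encode_prod_val, Nat.unpair_pair]
    induction n with
    | zero => simp [eΦ]
    | succ n ih =>
      simp only [encode_nat] at ih ⊢
      rw [ih]
      simpa using eΨ p (a, n, _)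
  exact key.comp (id.pair hf)

theorem ite {c : (ℕ → ℕ) → α → Prop} [∀ p a, Decidable (c p a)] {f g : (ℕ → ℕ) → α → β}
    (hc : OracleComputable fun p a => decide (c p a))
    (hf : OracleComputable f) (hg : OracleComputable g) :
    OracleComputable fun p a => if c p a then f p a else g p a := by
  have : Computable fun x : Bool × β × β => bif x.1 then x.2.1 else x.2.2 :=
    .cond .fst (Computable.fst.comp .snd) (Computable.snd.comp .snd)
  simpa [Bool.cond_decide] using (of_computable this).comp (hc.pair (hf.pair hg))

theorem dec_and {c d : (ℕ → ℕ) → α → Prop} [∀ p a, Decidable (c p a)] [∀ p a, Decidable (d p a)]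
    (hc : OracleComputable fun p a => decide (c p a))
    (hd : OracleComputable fun p a => decide (d p a)) :
    OracleComputable fun p a => decide (c p a ∧ d p a) := by
  simpa using map₂ (Primrec.and.to_comp) hc hd

theorem dec_le {f g : (ℕ → ℕ) → α → ℕ} (hf : OracleComputable f) (hg : OracleComputable g) :
    OracleComputable fun p a => decide (f p a ≤ g p a) :=
  map₂ (f := fun a b : ℕ => decide (a ≤ b)) Primrec.nat_le.decide.to_comp hf hg

theorem dec_lt {f g : (ℕ → ℕ) → α → ℕ} (hf : OracleComputable f) (hg : OracleComputable g) :
    OracleComputable fun p a => decide (f p a < g p a) :=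
  map₂ (f := fun a b : ℕ => decide (a < b)) Primrec.nat_lt.decide.to_comp hf hg

theorem dec_eq {f g : (ℕ → ℕ) → α → ℕ} (hf : OracleComputable f) (hg : OracleComputable g) :
    OracleComputable fun p a => decide (f p a = g p a) :=
  map₂ (f := fun a b : ℕ => decide (a = b)) Primrec.eq.decide.to_comp hf hg

theorem add {f g : (ℕ → ℕ) → α → ℕ} (hf : OracleComputable f) (hg : OracleComputable g) :
    OracleComputable fun p a => f p a + g p a := map₂ Primrec.nat_add.to_comp hf hg

theorem sub {f g : (ℕ → ℕ) → α → ℕ} (hf : OracleComputable f) (hg : OracleComputable g) :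
    OracleComputable fun p a => f p a - g p a := map₂ Primrec.nat_sub.to_comp hf hg

theorem mul {f g : (ℕ → ℕ) → α → ℕ} (hf : OracleComputable f) (hg : OracleComputable g) :
    OracleComputable fun p a => f p a * g p a := map₂ Primrec.nat_mul.to_comp hf hg

theorem div {f g : (ℕ → ℕ) → α → ℕ} (hf : OracleComputable f) (hg : OracleComputable g) :
    OracleComputable fun p a => f p a / g p a := map₂ Primrec.nat_div.to_comp hf hg

theorem mod {f g : (ℕ → ℕ) → α → ℕ} (hf : OracleComputable f) (hg : OracleComputable g) :
    OracleComputable fun p a => f p a % g p a := map₂ Primrec.nat_mod.to_comp hf hg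

theorem natPair {f g : (ℕ → ℕ) → α → ℕ} (hf : OracleComputable f) (hg : OracleComputable g) :
    OracleComputable fun p a => Nat.pair (f p a) (g p a) := map₂ Primrec₂.natPair.to_comp hf hg

theorem unpair_fst {f : (ℕ → ℕ) → α → ℕ} (hf : OracleComputable f) :
    OracleComputable fun p a => (f p a).unpair.1 :=
  fst.comp (map .unpair hf)

theorem unpair_snd {f : (ℕ → ℕ) → α → ℕ} (hf : OracleComputable f) :
    OracleComputable fun p a => (f p a).unpair.2 :=
  snd.comp (map .unpair hf)

theorem sum_range {f : (ℕ → ℕ) → α → ℕ} {g : (ℕ → ℕ) → α × ℕ → ℕ} (hf : OracleComputable f)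
    (hg : OracleComputable g) :
    OracleComputable fun p a => ∑ i ∈ Finset.range (f p a), g p (a, i) := by
  have := nat_rec hf (const 0) (h := fun p (x : α × ℕ × ℕ) => x.2.2 + g p (x.1, x.2.1))
    (add (snd.comp snd) (hg.comp (fst.pair (fst.comp snd))))
  convert this using 3 with p a
  induction f p a with
  | zero => rfl
  | succ n ih => rw [Finset.sum_range_succ, ih]

theorem dec_exists_lt {f : (ℕ → ℕ) → α → ℕ} {c : (ℕ → ℕ) → α × ℕ → Prop}
    [∀ p a, Decidable (c p a)] (hf : OracleComputable f)
    (hc : OracleComputable fun p a => decide (c p a)) :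
    OracleComputable fun p a => decide (∃ i < f p a, c p (a, i)) := by
  -- Bounded search as arithmetic: a witness exists iff the number of witnesses is positive.
  have := dec_lt (const 0) (sum_range hf (ite hc (const 1) (const 0)))
  convert this using 4 with p a
  rw [Finset.sum_pos_iff]
  simp only [Finset.mem_range]
  refine exists_congr fun i => and_congr_right fun _ => ?_
  split_ifs with h <;> simp [h]

theorem map_range {f : (ℕ → ℕ) → α → ℕ} {g : (ℕ → ℕ) → α × ℕ → β} (hf : OracleComputable f)
    (hg : OracleComputable g) :
    OracleComputable fun p a => (List.range (f p a)).map fun i => g p (a, i) := by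
  have := nat_rec hf (const []) (h := fun p (x : α × ℕ × List β) => x.2.2 ++ [g p (x.1, x.2.1)])
    (map₂ (f := fun (l : List β) b => l ++ [b]) Primrec.list_concat.to_comp (snd.comp snd) (hg.comp (fst.pair (fst.comp snd))))
  convert this using 3 with p a
  induction f p a with
  | zero => rfl
  | succ n ih => rw [List.range_succ, List.map_append, ih]; rfl

theorem getD {f : (ℕ → ℕ) → α → List β} {g : (ℕ → ℕ) → α → ℕ} (d : β) (hf : OracleComputable f)
    (hg : OracleComputable g) : OracleComputable fun p a => (f p a).getD (g p a) d :=
  map₂ (f := fun (l : List β) n => l.getD n d) (Primrec.list_getD d).to_comp hf hg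

theorem tail {x : (ℕ → ℕ) → ℕ → ℕ} (hx : OracleComputable x) :
    OracleComputable fun p => Weihrauch.tail (x p) :=
  hx.comp (add id (const 1))

end OracleComputable

end OracleComputable

theorem OracleComputable.computableFunctional {h : (ℕ → ℕ) → ℕ → ℕ} (hh : OracleComputable h) :
    ComputableFunctional fun p => Part.some (h p) := by
  obtain ⟨Φ, hΦ, e⟩ := hh
  refine ⟨Φ, hΦ, fun p q hq n => ?_⟩
  obtain rfl := Part.mem_some_iff.1 hq
  simpa using congrArg (h p n ∈ ·) (e p n)

/-! ### Pairing of sequences and reductions by total functionals. -/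

theorem bairePair_even (p q : ℕ → ℕ) (n : ℕ) : bairePair p q (2 * n) = p n := by
  simp [bairePair]

theorem bairePair_odd (p q : ℕ → ℕ) (n : ℕ) : bairePair p q (2 * n + 1) = q n := by
  rw [bairePair, if_neg (by omega)]; congr 1; omega

/-- The even half of a sequence. -/
def evens (r : ℕ → ℕ) : ℕ → ℕ := fun n => r (2 * n)

/-- The odd half of a sequence. -/
def odds (r : ℕ → ℕ) : ℕ → ℕ := fun n => r (2 * n + 1)

@[simp] theorem evens_bairePair (p q : ℕ → ℕ) : evens (bairePair p q) = p :=
  funext (bairePair_even p q)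

@[simp] theorem odds_bairePair (p q : ℕ → ℕ) : odds (bairePair p q) = q :=
  funext (bairePair_odd p q)

theorem OracleComputable.evens : OracleComputable evens :=
  apply (mul (const 2) id)

theorem OracleComputable.odds : OracleComputable odds :=
  apply (add (mul (const 2) id) (const 1))

theorem OracleComputable.bairePair {x y : (ℕ → ℕ) → ℕ → ℕ} (hx : OracleComputable x)
    (hy : OracleComputable y) : OracleComputable fun r => Weihrauch.bairePair (x r) (y r) :=
  ite (dec_eq (mod id (const 2)) (const 0)) (hx.comp (div id (const 2)))
    (hy.comp (div id (const 2)))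

/-- Computability of a functional of two sequences is expressed on their join; substituting the join
of `x r` and `y r` for the oracle gives composition in both arguments. -/
theorem OracleComputable.subst₂ {k : (ℕ → ℕ) → (ℕ → ℕ) → ℕ → ℕ} {x y : (ℕ → ℕ) → ℕ → ℕ}
    (hk : OracleComputable fun r => k (Weihrauch.evens r) (Weihrauch.odds r))
    (hx : OracleComputable x) (hy : OracleComputable y) :
    OracleComputable fun r => k (x r) (y r) := by
  simpa using hk.subst (hx.bairePair hy)

/-- A reduction given by total computable functionals `h` and `k`, where `k` takes a solution of
the instance `h p` and the instance `p`. -/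
def TotallyReducible (g f : Problem) : Prop :=
  ∃ (h : (ℕ → ℕ) → ℕ → ℕ) (k : (ℕ → ℕ) → (ℕ → ℕ) → ℕ → ℕ), OracleComputable h ∧
    (OracleComputable fun r => k (evens r) (odds r)) ∧
    ∀ p ∈ g.dom, h p ∈ f.dom ∧ ∀ s ∈ f.sol (h p), k s p ∈ g.sol p

theorem TotallyReducible.reducible {f g : Problem} (H : TotallyReducible g f) :
    Reducible g f := by
  obtain ⟨h, k, hh, hk, H⟩ := H
  refine ⟨_, _, hh.computableFunctional, hk.computableFunctional, fun F hF p hp => ?_⟩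
  obtain ⟨s, hs, hsol⟩ := hF _ (H p hp).1
  refine ⟨k s p, ?_, (H p hp).2 s hsol⟩
  simp only [Part.bind_some, Part.mem_bind_iff]
  exact ⟨s, hs, by simp⟩

theorem TotallyReducible.trans {e f g : Problem} (H : TotallyReducible g f)
    (H' : TotallyReducible f e) : TotallyReducible g e := by
  obtain ⟨h, k, hh, hk, H⟩ := H
  obtain ⟨h', k', hh', hk', H'⟩ := H'
  refine ⟨fun p => h' (h p), fun s p => k (k' s (h p)) p, hh'.subst hh,
    hk.subst₂ (hk'.subst₂ .evens (hh.subst .odds)) .odds, fun p hp => ?_⟩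
  have h₁ := H p hp
  have h₂ := H' _ h₁.1
  exact ⟨h₂.1, fun s hs => h₁.2 _ (h₂.2 s hs)⟩

/-- The sequence `p` with a new first entry. -/
def cons (m : ℕ) (p : ℕ → ℕ) : ℕ → ℕ := fun i => if i = 0 then m else p (i - 1)

@[simp] theorem cons_zero (m : ℕ) (p : ℕ → ℕ) : cons m p 0 = m := rfl

@[simp] theorem tail_cons (m : ℕ) (p : ℕ → ℕ) : tail (cons m p) = p := rfl

theorem OracleComputable.cons {m : (ℕ → ℕ) → ℕ} {x : (ℕ → ℕ) → ℕ → ℕ}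
    (hm : OracleComputable fun r (_ : ℕ) => m r) (hx : OracleComputable x) :
    OracleComputable fun r => Weihrauch.cons (m r) (x r) :=
  ite (dec_eq id (const 0)) hm (hx.comp (sub id (const 1)))

theorem OracleComputable.head {α : Type*} [Primcodable α] {x : (ℕ → ℕ) → ℕ → ℕ}
    (hx : OracleComputable x) : OracleComputable fun r (_ : α) => x r 0 :=
  hx.comp (const 0)

/-! ### Recurrence of colours after a bound. -/

theorem IsBound.exists_gt {f : ℕ → ℕ} {b x : ℕ} (hb : IsBound f b) (hx : b < x) (N : ℕ) :
    ∃ y > N, f x = f y := by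
  induction N with
  | zero =>
    obtain ⟨y, hy, h⟩ := hb x hx
    exact ⟨y, by omega, h⟩
  | succ N ih =>
    obtain ⟨y, hy, h⟩ := ih
    -- The later of `x` and `y` lies beyond `b` and has the colour of `x`, so the bound applies to
    -- it again.
    obtain ⟨z, hz, h'⟩ := hb (max x y) (lt_max_of_lt_left hx)
    rcases le_total x y with hxy | hxy
    · rw [max_eq_right hxy] at hz h'
      exact ⟨z, by omega, h.trans h'⟩
    · rw [max_eq_left hxy] at hz h'
      exact ⟨z, by omega, h'⟩

theorem IsBound.mono {f : ℕ → ℕ} {b b' : ℕ} (hb : IsBound f b) (h : b ≤ b') : IsBound f b' :=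
  fun x hx => hb x (h.trans_lt hx)

/-! ### From colourings of the natural numbers to totalized choice -/

/-- The colours among the first `p 0` ones that `tail p` takes strictly between `b` and `t`. -/
def coloursBetween (p : ℕ → ℕ) (b t : ℕ) : Finset ℕ :=
  {k ∈ Finset.range (p 0) | ∃ x < t, b < x ∧ tail p x = k}

/-- The `j`-th row enumerates the numbers after which `tail p` takes more than `j + 1` colours. -/
def boundInstance (p : ℕ → ℕ) : ℕ → ℕ := fun x =>
  if x.unpair.1 + 1 < (coloursBetween p x.unpair.2.unpair.1 x.unpair.2.unpair.2).card then
    x.unpair.2.unpair.1 + 1 else 0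

theorem mem_enumerated_boundInstance {p : ℕ → ℕ} {j b : ℕ} :
    b ∈ enumerated (row (boundInstance p) j) ↔ ∃ t, j + 1 < (coloursBetween p b t).card := by
  constructor
  · rintro ⟨i, hi⟩
    simp only [row, boundInstance, Nat.unpair_pair] at hi
    split_ifs at hi with h
    obtain rfl : i.unpair.1 = b := by omega
    exact ⟨_, h⟩
  · rintro ⟨t, ht⟩
    exact ⟨Nat.pair b t, by simp [row, boundInstance, ht]⟩

/-- The answer of the row indexed by the number of recurring colours minus one is already a bound,
and bounds are closed upwards; the sum avoids having to know that row. -/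
theorem isBound_of_choice {p s : ℕ → ℕ} (hp : p ∈ ECT.dom)
    (hs : s ∈ (TCN.power (p 0 - 1)).sol (boundInstance p)) :
    IsBound (tail p) (∑ j ∈ Finset.range (p 0 - 1), s (Nat.pair j 0)) := by
  classical
  set b := ∑ j ∈ Finset.range (p 0 - 1), s (Nat.pair j 0)
  obtain ⟨b₀, hb₀⟩ := exists_isBound hp
  obtain hle | hlt := le_or_gt b₀ b
  · exact hb₀.mono hle
  let R : Finset ℕ := {k ∈ Finset.range (p 0) | ∃ x, b₀ < x ∧ tail p x = k}
  have hR : ∀ {k}, k ∈ R ↔ ∃ x, b₀ < x ∧ tail p x = k := by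
    intro k
    simp only [R, Finset.mem_filter, Finset.mem_range, and_iff_right_iff_imp]
    rintro ⟨x, -, rfl⟩
    exact hp x
  have hRinf : ∀ k ∈ R, ∀ N, ∃ y > N, k = tail p y := by
    intro k hk N
    obtain ⟨x, hx, rfl⟩ := hR.1 hk
    exact hb₀.exists_gt hx N
  suffices h : ∀ x > b, tail p x ∈ R from fun x hx => hRinf _ (h x hx) x
  have hpos : 0 < R.card := Finset.card_pos.2 ⟨_, hR.2 ⟨b₀ + 1, by omega, rfl⟩⟩
  have hcard : R.card ≤ p 0 := (Finset.card_filter_le _ _).trans (Finset.card_range _).le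
  -- If all colours recur there is no row for this case, and none is needed.
  rcases hcard.eq_or_lt with heq | hlt'
  · intro x _
    have hall : R = Finset.range (p 0) := Finset.eq_of_subset_of_card_le (Finset.filter_subset _ _)
      (heq.ge.trans' (Finset.card_range _).le)
    rw [hall]
    exact Finset.mem_range.2 (hp x)
  have hj : R.card - 1 < p 0 - 1 := by omega
  set a := s (Nat.pair (R.card - 1) 0) with ha
  have hab : a ≤ b := Finset.single_le_sum (f := fun j => s (Nat.pair j 0))
    (fun _ _ => Nat.zero_le _) (Finset.mem_range.2 hj)
  -- After `b₀` only colours in `R` occur, so this row does not enumerate everything and its answer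
  -- must be a number that is not enumerated.
  have hne : b₀ ∉ enumerated (row (boundInstance p) (R.card - 1)) := by
    rw [mem_enumerated_boundInstance]
    rintro ⟨t, ht⟩
    have : coloursBetween p b₀ t ⊆ R := by
      intro k hk
      obtain ⟨-, x, -, hx⟩ := Finset.mem_filter.1 hk
      exact hR.2 ⟨x, hx⟩
    have := Finset.card_le_card this
    omega
  have hna : a ∉ enumerated (row (boundInstance p) (R.card - 1)) :=
    (hs _ hj).resolve_right fun h => hne (h ▸ Set.mem_univ _)
  rw [mem_enumerated_boundInstance] at hna
  intro x hx
  by_contra hxR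
  refine hna ?_
  choose! y hy hy' using fun k hk => hRinf k hk a
  -- By this time a non-recurring colour at `x` and every colour of `R` would have been seen after
  -- `a`: one colour too many. The sum dominates each `y k`.
  refine ⟨x + 1 + ∑ k ∈ R, (y k + 1), ?_⟩
  have hsub : insert (tail p x) R ⊆ coloursBetween p a (x + 1 + ∑ k ∈ R, (y k + 1)) := by
    intro k hk
    rw [Finset.mem_insert] at hk
    rw [coloursBetween, Finset.mem_filter, Finset.mem_range]
    rcases hk with rfl | hk
    · exact ⟨hp x, x, by omega, by omega, rfl⟩
    · refine ⟨(hy' k hk) ▸ hp _, y k, ?_, hy k hk, (hy' k hk).symm⟩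
      have : y k + 1 ≤ ∑ k ∈ R, (y k + 1) :=
        Finset.single_le_sum (f := fun k => y k + 1) (fun _ _ => Nat.zero_le _) hk
      omega
  have := Finset.card_le_card hsub
  rw [Finset.card_insert_of_notMem hxR] at this
  omega

theorem OracleComputable.boundInstance : OracleComputable boundInstance := by
  have hc : OracleComputable fun p (x : ℕ) =>
      (coloursBetween p x.unpair.2.unpair.1 x.unpair.2.unpair.2).card := by
    simp only [coloursBetween, Finset.card_filter]
    have hu : OracleComputable fun (_ : ℕ → ℕ) (a : (ℕ × ℕ) × ℕ) => a.1.1.unpair.2 :=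
      unpair_snd (fst.comp fst)
    exact sum_range (g := fun p (a : ℕ × ℕ) =>
        if ∃ x < a.1.unpair.2.unpair.2, a.1.unpair.2.unpair.1 < x ∧ Weihrauch.tail p x = a.2
          then 1 else 0) (head id.apply)
      (ite (dec_exists_lt (c := fun p (a : (ℕ × ℕ) × ℕ) =>
          a.1.1.unpair.2.unpair.1 < a.2 ∧ Weihrauch.tail p a.2 = a.1.2)
        (unpair_snd (unpair_snd fst))
        (dec_and (dec_lt (unpair_fst hu) snd)
          (dec_eq ((tail id.apply).comp snd) (snd.comp fst)))) (const 1) (const 0))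
  exact ite (dec_lt (add (unpair_fst id) (const 1)) hc)
    (add (unpair_fst (unpair_snd id)) (const 1)) (const 0)

theorem OracleComputable.sum_answers {M : (ℕ → ℕ) → ℕ} {x : (ℕ → ℕ) → ℕ → ℕ}
    (hM : OracleComputable fun r (_ : ℕ) => M r) (hx : OracleComputable x) :
    OracleComputable fun r (_ : ℕ) => ∑ j ∈ Finset.range (M r), x r (Nat.pair j 0) :=
  sum_range (g := fun r (a : ℕ × ℕ) => x r (Nat.pair a.2 0)) hM (hx.comp (natPair snd (const 0)))

theorem ECT_withFirst_totallyReducible_power (n : ℕ) :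
    TotallyReducible (ECT.withFirst n) (TCN.power (n - 1)) := by
  refine ⟨boundInstance, fun s _ _ => ∑ j ∈ Finset.range (n - 1), s (Nat.pair j 0),
    .boundInstance, .sum_answers (.const _) .evens, ?_⟩
  rintro p ⟨hp, rfl⟩
  exact ⟨fun _ _ => Set.mem_univ _, fun s hs => isBound_of_choice hp hs⟩

theorem ECT_totallyReducible_finPar : TotallyReducible ECT TCN.finPar := by
  refine ⟨fun p => cons (p 0 - 1) (boundInstance p),
    fun s p _ => ∑ j ∈ Finset.range (p 0 - 1), tail s (Nat.pair j 0),
    .cons (.sub (.head (.apply .id)) (.const 1)) .boundInstance,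
    .sum_answers (.sub (.head .odds) (.const 1)) (.tail .evens), fun p hp => ?_⟩
  exact ⟨fun _ _ => Set.mem_univ _, fun s hs => isBound_of_choice hp hs.2⟩

/-! ### From totalized choice to colourings of the natural numbers -/

/-- The candidate at time `t` for a number that the `j`-th row of `p` does not enumerate. -/
def candidate (p : ℕ → ℕ) (j t : ℕ) : ℕ :=
  Nat.rec 0 (fun t a => if ∃ i < t, p (Nat.pair j i) = a + 1 then a + 1 else a) t

/-- At time `t` the candidate for the `j`-th row of `p` turns out to be enumerated. -/
def Refuted (p : ℕ → ℕ) (j t : ℕ) : Prop := ∃ i < t, p (Nat.pair j i) = candidate p j t + 1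

instance (p : ℕ → ℕ) (j t : ℕ) : Decidable (Refuted p j t) :=
  inferInstanceAs (Decidable (∃ i < t, p (Nat.pair j i) = candidate p j t + 1))

theorem candidate_succ (p : ℕ → ℕ) (j t : ℕ) :
    candidate p j (t + 1) = if Refuted p j t then candidate p j t + 1 else candidate p j t := rfl

/-- At time `(m + 1) * t + j` the colouring has the colour `j < m` if the event `E j t`
happens, and the default colour `m` otherwise. -/
def eventColouring (m : ℕ) (E : ℕ → ℕ → Prop) [∀ j t, Decidable (E j t)] : ℕ → ℕ := fun x =>
  if x % (m + 1) < m ∧ E (x % (m + 1)) (x / (m + 1)) then x % (m + 1) else m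

theorem eventColouring_lt (m : ℕ) (E : ℕ → ℕ → Prop) [∀ j t, Decidable (E j t)] (x : ℕ) :
    eventColouring m E x < m + 1 := by
  unfold eventColouring
  split_ifs with h <;> omega

theorem eventColouring_eq_iff {m j : ℕ} {E : ℕ → ℕ → Prop} [∀ j t, Decidable (E j t)] {x : ℕ}
    (hj : j < m) : eventColouring m E x = j ↔ x % (m + 1) = j ∧ E j (x / (m + 1)) := by
  unfold eventColouring
  constructor
  · intro h
    split_ifs at h with h'
    · exact ⟨h, h ▸ h'.2⟩
    · omega
  · rintro ⟨rfl, h⟩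
    rw [if_pos ⟨hj, h⟩]

/-- After a bound for the colouring an event of any kind happens never or infinitely often. -/
theorem event_dichotomy {m j b : ℕ} {E : ℕ → ℕ → Prop} [∀ j t, Decidable (E j t)]
    (hb : IsBound (eventColouring m E) b) (hj : j < m) :
    (∀ t > b, ¬ E j t) ∨ ∀ N, ∃ t > N, E j t := by
  by_cases h : ∀ t > b, ¬ E j t
  · exact .inl h
  push Not at h
  obtain ⟨t, ht, hE⟩ := h
  refine .inr fun N => ?_
  have hmod : ((m + 1) * t + j) % (m + 1) = j := by
    rw [Nat.mul_add_mod, Nat.mod_eq_of_lt (by omega)]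
  have hdiv : ((m + 1) * t + j) / (m + 1) = t := by
    rw [Nat.mul_add_div (by omega), Nat.div_eq_of_lt (by omega), add_zero]
  have hcol : eventColouring m E ((m + 1) * t + j) = j :=
    (eventColouring_eq_iff hj).2 ⟨hmod, by rwa [hdiv]⟩
  have hgt : b < (m + 1) * t + j := by nlinarith
  -- Positions beyond `(m + 1) * (N + 1)` belong to times after `N`.
  obtain ⟨y, hy, hy'⟩ := hb.exists_gt hgt ((m + 1) * (N + 1))
  have := (eventColouring_eq_iff hj).1 (hy'.symm.trans hcol)
  refine ⟨_, ?_, this.2⟩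
  have : N + 1 ≤ y / (m + 1) := (Nat.le_div_iff_mul_le (by omega)).2 (by nlinarith)
  omega

/-- A counter that is incremented at the events of a sequence of times stays constant if the event
does not happen any more. -/
theorem counter_eq {a : ℕ → ℕ} {E : ℕ → Prop} {b t : ℕ}
    (ha : ∀ t, ¬ E t → a (t + 1) = a t) (h : ∀ t > b, ¬ E t) (ht : b < t) : a t = a (b + 1) := by
  induction t, ht using Nat.le_induction with
  | base => rfl
  | succ t ht ih => rw [ha t (h t ht), ih]

/-- A counter that is incremented at infinitely many events passes each large value at an event. -/
theorem counter_surjective {a : ℕ → ℕ} {E : ℕ → Prop}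
    (ha : ∀ t, ¬ E t → a (t + 1) = a t) (ha' : ∀ t, E t → a (t + 1) = a t + 1)
    (h : ∀ N, ∃ t > N, E t) {v : ℕ} (hv : a 0 ≤ v) : ∃ t, a t = v ∧ E t := by
  have hmono : Monotone a := monotone_nat_of_le_succ fun t => by
    by_cases hE : E t
    · rw [ha' t hE]; omega
    · rw [ha t hE]
  have hunb : ∀ N, ∃ t, N < a t := by
    intro N
    induction N with
    | zero =>
      obtain ⟨t, -, ht⟩ := h 0
      exact ⟨t + 1, by rw [ha' t ht]; omega⟩
    | succ N ih =>
      obtain ⟨s, hs⟩ := ih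
      obtain ⟨t, hst, ht⟩ := h s
      exact ⟨t + 1, by rw [ha' t ht]; have := hmono hst.le; omega⟩
  classical
  have hex := hunb v
  have hpos : Nat.find hex ≠ 0 := fun h0 => by
    have := Nat.find_spec hex
    rw [h0] at this
    omega
  obtain ⟨t, ht⟩ := Nat.exists_eq_succ_of_ne_zero hpos
  have h₁ : v < a (t + 1) := by
    have := Nat.find_spec hex
    rwa [ht] at this
  -- `t` is the last time before the counter exceeds `v`. Steps have size one, so the counter equals
  -- `v` there and is about to move.
  have h₂ : a t ≤ v := not_lt.1 (Nat.find_min hex (by omega))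
  have hE : E t := by
    by_contra hE
    rw [ha t hE] at h₁
    omega
  rw [ha' t hE] at h₁
  exact ⟨t, by omega, hE⟩

/-- If refutations stop, an enumeration of the final candidate would cause another one. If they
never stop, the candidate passes every number, and it leaves a number only because that number is
enumerated. -/
theorem candidate_spec {m j b : ℕ} {p : ℕ → ℕ} (hb : IsBound (eventColouring m (Refuted p)) b)
    (hj : j < m) :
    candidate p j (b + 1) ∉ enumerated (row p j) ∨ enumerated (row p j) = Set.univ := by
  have ha : ∀ t, ¬ Refuted p j t → candidate p j (t + 1) = candidate p j t :=
    fun t h => by rw [candidate_succ, if_neg h]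
  have ha' : ∀ t, Refuted p j t → candidate p j (t + 1) = candidate p j t + 1 :=
    fun t h => by rw [candidate_succ, if_pos h]
  rcases event_dichotomy hb hj with h | h
  · left
    rintro ⟨i, hi⟩
    have ht : b < b + 1 + i := by omega
    refine h (b + 1 + (i + 1)) (by omega) ⟨i, by omega, ?_⟩
    rw [counter_eq ha h (by omega)]
    exact hi
  · right
    refine Set.eq_univ_of_forall fun v => ?_
    obtain ⟨t, rfl, i, -, hi⟩ := counter_surjective ha ha' h (Nat.zero_le v)
    exact ⟨i, hi⟩

theorem OracleComputable.candidate {α : Type*} [Primcodable α] {x : (ℕ → ℕ) → ℕ → ℕ}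
    {f g : (ℕ → ℕ) → α → ℕ}
    (hx : OracleComputable x) (hf : OracleComputable f) (hg : OracleComputable g) :
    OracleComputable fun r a => candidate (x r) (f r a) (g r a) := by
  refine nat_rec (h := fun r (y : α × ℕ × ℕ) =>
    if ∃ i < y.2.1, x r (Nat.pair (f r y.1) i) = y.2.2 + 1 then y.2.2 + 1 else y.2.2)
    hg (const 0) (ite (dec_exists_lt (c := fun r (z : (α × ℕ × ℕ) × ℕ) =>
      x r (Nat.pair (f r z.1.1) z.2) = z.1.2.2 + 1) (fst.comp snd) ?_) ?_ (snd.comp snd))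
  · exact dec_eq (hx.comp (natPair (hf.comp (fst.comp fst)) snd))
      (add (snd.comp (snd.comp fst)) (const 1))
  · exact add (snd.comp snd) (const 1)

theorem OracleComputable.dec_refuted {α : Type*} [Primcodable α] {x : (ℕ → ℕ) → ℕ → ℕ}
    {f g : (ℕ → ℕ) → α → ℕ}
    (hx : OracleComputable x) (hf : OracleComputable f) (hg : OracleComputable g) :
    OracleComputable fun r a => decide (Refuted (x r) (f r a) (g r a)) :=
  dec_exists_lt (c := fun r (y : α × ℕ) =>
      x r (Nat.pair (f r y.1) y.2) = Weihrauch.candidate (x r) (f r y.1) (g r y.1) + 1) hg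
    (dec_eq (hx.comp (natPair (hf.comp fst) snd))
      (add (candidate hx (hf.comp fst) (hg.comp fst)) (const 1)))

theorem OracleComputable.eventColouring {m : (ℕ → ℕ) → ℕ} {E : (ℕ → ℕ) → ℕ → ℕ → Prop}
    [∀ r j t, Decidable (E r j t)] (hm : OracleComputable fun r (_ : ℕ) => m r)
    (hE : OracleComputable fun r (x : ℕ × ℕ) => decide (E r x.1 x.2)) :
    OracleComputable fun r => eventColouring (m r) (E r) := by
  have hmod : OracleComputable fun r x => x % (m r + 1) := mod id (add hm (const 1))
  have hdiv : OracleComputable fun r x => x / (m r + 1) := div id (add hm (const 1))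
  exact ite (dec_and (dec_lt hmod hm) (hE.comp (hmod.pair hdiv))) hmod hm

theorem power_totallyReducible_ECT_withFirst (m : ℕ) :
    TotallyReducible (TCN.power m) (ECT.withFirst (m + 1)) := by
  refine ⟨fun p => cons (m + 1) (eventColouring m (Refuted p)),
    fun s p x => candidate p x.unpair.1 (s 0 + 1),
    .cons (.const _) (.eventColouring (.const _) (.dec_refuted (.apply .id) .fst .snd)),
    .candidate .odds (.unpair_fst .id) (.add (.head .evens) (.const 1)), fun p _ => ?_⟩
  refine ⟨⟨eventColouring_lt m _, rfl⟩, fun s hs j hj => ?_⟩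
  have := candidate_spec hs hj
  simpa [TCN, row] using this

theorem finPar_totallyReducible_ECT : TotallyReducible TCN.finPar ECT := by
  refine ⟨fun p => cons (p 0 + 1) (eventColouring (p 0) (Refuted (tail p))),
    fun s p => cons (p 0) fun x => candidate (tail p) x.unpair.1 (s 0 + 1),
    .cons (.add (.head (.apply .id)) (.const 1))
      (.eventColouring (.head (.apply .id)) (.dec_refuted (.tail (.apply .id)) .fst .snd)),
    .cons (.head .odds)
      (.candidate (.tail .odds) (.unpair_fst .id) (.add (.head .evens) (.const 1))),
    fun p _ => ?_⟩
  refine ⟨eventColouring_lt (p 0) _, fun s hs => ⟨rfl, fun j hj => ?_⟩⟩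
  have := candidate_spec hs hj
  simpa [TCN, row] using this

/-- A reduction between problems with instances `(n, x)` that keeps the number `n`. -/
theorem TotallyReducible.of_head_eq {f g : Problem} (h : (ℕ → ℕ) → ℕ → ℕ)
    (k : (ℕ → ℕ) → (ℕ → ℕ) → ℕ → ℕ) (hh : OracleComputable h)
    (hk : OracleComputable fun r => k (evens r) (odds r)) (hhead : ∀ p, h p 0 = p 0)
    (H : ∀ p ∈ g.dom, h p ∈ f.dom ∧ ∀ s ∈ f.sol (h p), k s p ∈ g.sol p) :
    TotallyReducible g f ∧ ∀ n, TotallyReducible (g.withFirst n) (f.withFirst n) :=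
  ⟨⟨h, k, hh, hk, H⟩, fun _ => ⟨h, k, hh, hk, fun p hp =>
    ⟨⟨(H p hp.1).1, (hhead p).trans hp.2⟩, (H p hp.1).2⟩⟩⟩

/-! ### Rational numbers and their codes -/

/-- Cross-multiplied, with the subtracted terms moved across, so that the order is decided by
arithmetic in `ℕ`. -/
theorem ratOfCode_le_iff (i j : ℕ) : ratOfCode i ≤ ratOfCode j ↔
    i.unpair.1.unpair.1 * (j.unpair.2 + 1) + j.unpair.1.unpair.2 * (i.unpair.2 + 1) ≤
      j.unpair.1.unpair.1 * (i.unpair.2 + 1) + i.unpair.1.unpair.2 * (j.unpair.2 + 1) := by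
  have hi : (0 : ℚ) < i.unpair.2 + 1 := by positivity
  have hj : (0 : ℚ) < j.unpair.2 + 1 := by positivity
  rw [ratOfCode, ratOfCode, div_le_div_iff₀ hi hj, ← Nat.cast_le (α := ℚ)]
  push_cast
  constructor <;> intro h <;> linarith

theorem OracleComputable.dec_ratOfCode_le {α : Type*} [Primcodable α] {f g : (ℕ → ℕ) → α → ℕ}
    (hf : OracleComputable f) (hg : OracleComputable g) :
    OracleComputable fun r a => decide (ratOfCode (f r a) ≤ ratOfCode (g r a)) := by
  simp only [ratOfCode_le_iff]
  have hsf := add (unpair_snd hf) (const 1)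
  have hsg := add (unpair_snd hg) (const 1)
  exact dec_le (add (mul (unpair_fst (unpair_fst hf)) hsg) (mul (unpair_snd (unpair_fst hg)) hsf))
    (add (mul (unpair_fst (unpair_fst hg)) hsf) (mul (unpair_snd (unpair_fst hf)) hsg))

theorem OracleComputable.dec_ratOfCode_lt {α : Type*} [Primcodable α] {f g : (ℕ → ℕ) → α → ℕ}
    (hf : OracleComputable f) (hg : OracleComputable g) :
    OracleComputable fun r a => decide (ratOfCode (f r a) < ratOfCode (g r a)) := by
  simpa only [← not_le, decide_not] using map Primrec.not.to_comp (dec_ratOfCode_le hg hf)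

theorem OracleComputable.nat_find {α : Type*} [Primcodable α] {c : (ℕ → ℕ) → α → ℕ → Prop}
    [∀ p a n, Decidable (c p a n)] (h : ∀ p a, ∃ n, c p a n)
    (hc : OracleComputable fun p (x : α × ℕ) => decide (c p x.1 x.2)) :
    OracleComputable fun p a => Nat.find (h p a) := by
  -- `OracleRec.rfind` searches for a zero, so truth is represented by `0`.
  obtain ⟨Φ, hΦ, e⟩ := ite (c := fun p (x : α × ℕ) => c p x.1 x.2) hc (const 0) (const 1)
  refine ⟨_, .rfind hΦ, fun p a => Part.eq_some_iff.2 ?_⟩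
  have e' : ∀ n, Φ p (Nat.pair (Encodable.encode a) n) = Part.some (if c p a n then 0 else 1) :=
    fun n => by simpa using e p (a, n)
  simp only [e', Part.map_some]
  refine Nat.mem_rfind.2 ⟨?_, fun {m} hm => ?_⟩
  · have := Nat.find_spec (h p a)
    simp [this]
  · have := Nat.find_min (h p a) hm
    simp [this]

/-! ### Shuffles -/

theorem IsShuffle.exists_between {c : ℚ → ℕ} {u v : ℚ} (h : IsShuffle c u v) {x y z : ℚ}
    (hx : x ∈ Set.Ioo u v) (hy : y ∈ Set.Ioo u v) (hz : z ∈ Set.Ioo u v) (hxy : x < y) :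
    ∃ w, x < w ∧ w < y ∧ c w = c z := by
  obtain ⟨m, D, hD, -, hdense⟩ := h
  rw [← hD, Set.mem_iUnion] at hz
  obtain ⟨i, hi⟩ := hz
  obtain ⟨w, hw, hxw, hwy⟩ := (hdense i).1 x hx y hy hxy
  exact ⟨w, hxw, hwy, (hdense i).2 w hw z hi⟩

/-- The colour classes form the partition; it is finite since there are only finitely many colours.
Thus a shuffle is an interval in which every occurring colour is dense. -/
theorem IsShuffle.of_exists_between {k : ℕ} {c : ℚ → ℕ} {u v : ℚ} (hc : ∀ x, c x < k)
    (h : ∀ x ∈ Set.Ioo u v, ∀ y ∈ Set.Ioo u v, ∀ z ∈ Set.Ioo u v, x < y →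
      ∃ w, x < w ∧ w < y ∧ c w = c z) : IsShuffle c u v := by
  have hfin : (c '' Set.Ioo u v).Finite :=
    (Set.finite_Iio k).subset (by rintro _ ⟨x, _, rfl⟩; exact hc x)
  have : Finite (c '' Set.Ioo u v) := hfin
  obtain ⟨m, ⟨e⟩⟩ := Finite.exists_equiv_fin (c '' Set.Ioo u v)
  refine ⟨m, fun i => {x | x ∈ Set.Ioo u v ∧ c x = (e.symm i : ℕ)}, ?_, ?_, ?_⟩
  · ext x
    rw [Set.mem_iUnion]
    exact ⟨fun ⟨_, h, _⟩ => h,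
      fun h => ⟨e ⟨c x, Set.mem_image_of_mem c h⟩, h, by simp⟩⟩
  · intro i j hij
    refine Set.disjoint_left.2 fun x hx hy => hij ?_
    exact e.symm.injective (Subtype.ext (hx.2.symm.trans hy.2))
  · refine fun i => ⟨fun x hx y hy hxy => ?_, fun z hz w hw => hz.2.trans hw.2.symm⟩
    obtain ⟨z, hz, hcz⟩ := (e.symm i).2
    obtain ⟨w, hxw, hwy, hw⟩ := h x hx y hy z hz hxy
    exact ⟨w, ⟨⟨hx.1.trans hxw, hwy.trans hy.2⟩, hw.trans hcz⟩, hxw, hwy⟩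

/-! ### From colourings of the natural numbers to colourings of the rationals -/

/-- `y ! * r` is an integer. -/
def FactorialIntegral (r : ℚ) (y : ℕ) : Prop := ∃ z : ℤ, (y.factorial : ℚ) * r = z

theorem FactorialIntegral.mono {r : ℚ} {y y' : ℕ} (h : FactorialIntegral r y) (hy : y ≤ y') :
    FactorialIntegral r y' := by
  obtain ⟨z, hz⟩ := h
  obtain ⟨d, hd⟩ := Nat.factorial_dvd_factorial hy
  exact ⟨d * z, by rw [hd]; push_cast; rw [← hz]; ring⟩

theorem factorialIntegral_ratOfCode (i y : ℕ) : FactorialIntegral (ratOfCode i) y ↔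
    (y.factorial * i.unpair.1.unpair.1) % (i.unpair.2 + 1) =
      (y.factorial * i.unpair.1.unpair.2) % (i.unpair.2 + 1) := by
  have hd : ((i.unpair.2 : ℚ) + 1) ≠ 0 := by positivity
  change _ ↔ _ ≡ _ [MOD _]
  rw [Nat.ModEq.comm, Nat.modEq_iff_dvd, FactorialIntegral]
  refine exists_congr fun z => ?_
  rw [ratOfCode, ← mul_div_assoc, div_eq_iff hd, ← Int.cast_inj (α := ℚ)]
  push_cast
  constructor <;> intro h <;> linarith

theorem exists_factorialIntegral (r : ℚ) : ∃ y, FactorialIntegral r y := by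
  obtain ⟨d, hd⟩ := Nat.dvd_factorial r.den_pos le_rfl
  refine ⟨r.den, d * r.num, ?_⟩
  conv_lhs => rw [hd, ← Rat.num_div_den r]
  have : (r.den : ℚ) ≠ 0 := by exact_mod_cast r.den_ne_zero
  push_cast
  field_simp
  simp [Rat.num_div_den]

open Classical in
/-- The least number `y` such that `y ! * r` is an integer. -/
noncomputable def level (r : ℚ) : ℕ := Nat.find (exists_factorialIntegral r)

theorem level_le_iff {r : ℚ} {y : ℕ} : level r ≤ y ↔ FactorialIntegral r y := by
  classical
  rw [level, Nat.find_le_iff]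
  exact ⟨fun ⟨m, hm, h⟩ => h.mono hm, fun h => ⟨y, le_rfl, h⟩⟩

theorem OracleComputable.factorial {α : Type*} [Primcodable α] {f : (ℕ → ℕ) → α → ℕ}
    (hf : OracleComputable f) : OracleComputable fun r a => (f r a).factorial := by
  have := nat_rec hf (const 1) (h := fun _ (y : α × ℕ × ℕ) => (y.2.1 + 1) * y.2.2)
    (mul (add (fst.comp snd) (const 1)) (snd.comp snd))
  convert this using 3 with r a
  induction f r a with
  | zero => rfl
  | succ n ih => rw [Nat.factorial_succ, ih]

theorem OracleComputable.level : OracleComputable fun _ i => level (ratOfCode i) := by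
  have hex (i : ℕ) : ∃ y : ℕ, (y.factorial * i.unpair.1.unpair.1) % (i.unpair.2 + 1) =
      (y.factorial * i.unpair.1.unpair.2) % (i.unpair.2 + 1) := by
    simpa only [factorialIntegral_ratOfCode] using exists_factorialIntegral (ratOfCode i)
  have := nat_find (fun _ => hex) (dec_eq
    (mod (mul (factorial snd) (unpair_fst (unpair_fst fst))) (add (unpair_snd fst) (const 1)))
    (mod (mul (factorial snd) (unpair_snd (unpair_fst fst))) (add (unpair_snd fst) (const 1))))
  convert this using 3 with _ i
  unfold Weihrauch.level
  classical
  exact Nat.find_congr' fun {y} => factorialIntegral_ratOfCode i y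

/-- Every rational has a code, so the colouring existentially quantified in a solution of `iShuffle`
is the intended one. -/
theorem NamesColouring.unique {p : ℕ → ℕ} {c c' : ℚ → ℕ} (h : NamesColouring p c)
    (h' : NamesColouring p c') : c = c' := by
  funext x
  obtain ⟨i, rfl⟩ := ratOfCode_surjective x
  rw [← h.2, ← h'.2]

/-- Intervals that are not too short contain rationals of level `x`. -/
theorem exists_level_eq {u v : ℚ} {N x : ℕ} (hN : 1 ≤ N * (v - u)) (hx : N + 1 < x) :
    ∃ r, u < r ∧ r < v ∧ level r = x := by
  obtain ⟨y, rfl⟩ : ∃ y, x = y + 1 := ⟨x - 1, by omega⟩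
  have hfac : (N : ℚ) < y.factorial := by
    exact_mod_cast (show N < y by omega).trans_le (Nat.self_le_factorial y)
  have hy : (0 : ℚ) < y.factorial := by positivity
  have hy1 : (0 : ℚ) < (y : ℚ) + 1 := by positivity
  have hpos : 0 < v - u := by
    by_contra! h
    have := mul_nonpos_of_nonneg_of_nonpos (Nat.cast_nonneg (α := ℚ) N) h
    linarith
  have hlen : 1 < y.factorial * (v - u) :=
    hN.trans_lt (mul_lt_mul_of_pos_right hfac hpos)
  have hu : y.factorial * u = (y.factorial * (y + 1) * u - 1) / (y + 1) + 1 / (y + 1) := by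
    field_simp; ring
  -- The witness is `r` with `y ! * r = m + 1 / (y + 1)`: multiplying by `y + 1` gives an integer,
  -- but `y ! * r` is none. The least such value above `y ! * u` is at most `y ! * u + 1`, hence
  -- below `y ! * v`.
  set m : ℤ := ⌊((y.factorial * (y + 1) * u - 1) / (y + 1) : ℚ)⌋ + 1 with hm
  have h₁ : (y.factorial * (y + 1) * u - 1) / (y + 1) < (m : ℚ) := by
    rw [hm]; push_cast; exact Int.lt_floor_add_one _
  have h₂ : (m : ℚ) ≤ (y.factorial * (y + 1) * u - 1) / (y + 1) + 1 := by
    rw [hm]; push_cast; linarith [Int.floor_le ((y.factorial * (y + 1) * u - 1) / (y + 1) : ℚ)]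
  have hfr : (y.factorial : ℚ) * ((m + 1 / (y + 1)) / y.factorial) = m + 1 / (y + 1) := by
    field_simp
  refine ⟨(m + 1 / (y + 1)) / y.factorial, ?_, ?_, le_antisymm ?_ ?_⟩
  · rw [lt_div_iff₀ hy]; linarith
  · rw [div_lt_iff₀ hy]; linarith
  · rw [level_le_iff]
    refine ⟨m * (y + 1) + 1, ?_⟩
    rw [Nat.factorial_succ]
    push_cast
    rw [mul_assoc, hfr]
    field_simp
  · by_contra! hlt
    obtain ⟨z, hz⟩ := level_le_iff.1 (Nat.lt_succ_iff.1 hlt)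
    rw [hfr] at hz
    have h₃ : (0 : ℚ) < 1 / (y + 1) := by positivity
    have h₄ : (1 : ℚ) / (y + 1) < 1 := by
      rw [div_lt_one hy1]
      have : (0 : ℚ) < y := by exact_mod_cast (show 0 < y by omega)
      linarith
    have h₅ : (m : ℚ) < z := by linarith
    have h₆ : (z : ℚ) < m + 1 := by linarith
    norm_cast at h₅ h₆
    omega

/-- To the right of any rational there is an interval without rationals of small level. -/
theorem exists_gap (r : ℚ) (x : ℕ) : ∃ r' > r, ∀ w, r < w → w < r' → x < level w := by
  have hx : (0 : ℚ) < x.factorial := by positivity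
  -- Rationals of level at most `x` are the multiples of `1 / x !`; this is the next one after `r`.
  refine ⟨(⌊(x.factorial : ℚ) * r⌋ + 1) / x.factorial, ?_, fun w hrw hw => ?_⟩
  · rw [gt_iff_lt, lt_div_iff₀ hx, mul_comm]
    exact Int.lt_floor_add_one _
  · by_contra! h
    obtain ⟨z, hz⟩ := level_le_iff.1 h
    rw [lt_div_iff₀ hx, mul_comm, hz] at hw
    have hlt : (x.factorial : ℚ) * r < z := hz ▸ mul_lt_mul_of_pos_left hrw hx
    have := (Int.floor_le ((x.factorial : ℚ) * r)).trans_lt hlt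
    norm_cast at this hw
    omega

/-- Every level `x > N + 1` occurs in the interval at some `r`. Density of the colour of `r` in the
gap to its right yields a larger level of the same colour. -/
theorem isBound_of_isShuffle {f : ℕ → ℕ} {u v : ℚ} {N : ℕ} (hN : 1 ≤ N * (v - u))
    (h : IsShuffle (fun r => f (level r)) u v) : IsBound f (N + 1) := by
  intro x hx
  obtain ⟨r, hur, hrv, rfl⟩ := exists_level_eq hN hx
  obtain ⟨r', hr', hgap⟩ := exists_gap r (level r)
  obtain ⟨t, hrt, ht⟩ := exists_between (lt_min hr' hrv)
  obtain ⟨w, hrw, hwt, hw⟩ := h.exists_between ⟨hur, hrv⟩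
    ⟨hur.trans hrt, ht.trans_le (min_le_right _ _)⟩ ⟨hur, hrv⟩ hrt
  exact ⟨level w, hgap w hrw (hwt.trans (ht.trans_le (min_le_left _ _))), hw.symm⟩

/-- The difference is positive, and the product of the denominators makes it an integer. -/
theorem one_le_mul_ratOfCode_sub {i j : ℕ} (h : ratOfCode i < ratOfCode j) :
    1 ≤ (((i.unpair.2 + 1) * (j.unpair.2 + 1) : ℕ) : ℚ) * (ratOfCode j - ratOfCode i) := by
  have hi : ((i.unpair.2 : ℚ) + 1) ≠ 0 := by positivity
  have hj : ((j.unpair.2 : ℚ) + 1) ≠ 0 := by positivity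
  have hle := mt (ratOfCode_le_iff j i).2 h.not_ge
  rw [not_le, ← Nat.add_one_le_iff, ← Nat.cast_le (α := ℚ)] at hle
  push_cast at hle ⊢
  have : (i.unpair.2 + 1) * (j.unpair.2 + 1) * (ratOfCode j - ratOfCode i) =
      ((j.unpair.1.unpair.1 : ℚ) - j.unpair.1.unpair.2) * (i.unpair.2 + 1) -
        ((i.unpair.1.unpair.1 : ℚ) - i.unpair.1.unpair.2) * (j.unpair.2 + 1) := by
    rw [ratOfCode, ratOfCode]
    field_simp
  rw [this]
  linarith

theorem ECT_totallyReducible_iShuffle : TotallyReducible ECT iShuffle ∧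
    ∀ n, TotallyReducible (ECT.withFirst n) (iShuffle.withFirst n) := by
  refine TotallyReducible.of_head_eq (fun p => cons (p 0) fun i => tail p (level (ratOfCode i)))
    (fun s _ _ => ((s 0).unpair.2 + 1) * ((s 1).unpair.2 + 1) + 1)
    (.cons (.head (.apply .id)) (.comp (.tail (.apply .id)) .level)) ?_ (fun _ => rfl) ?_
  · have h₀ (n : ℕ) : OracleComputable fun r (_ : ℕ) => evens r n :=
      OracleComputable.evens.comp (.const n)
    exact .add (.mul (.add (.unpair_snd (h₀ 0)) (.const 1)) (.add (.unpair_snd (h₀ 1)) (.const 1)))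
      (.const 1)
  · intro p hp
    have hnames : NamesColouring (cons (p 0) fun i => tail p (level (ratOfCode i)))
        fun r => tail p (level r) := ⟨fun x => hp _, fun i => rfl⟩
    refine ⟨⟨_, hnames⟩, ?_⟩
    rintro s ⟨hlt, c, hc, hs⟩
    obtain rfl := hc.unique hnames
    exact isBound_of_isShuffle (one_le_mul_ratOfCode_sub hlt) hs

/-! ### From colourings of the rationals to colourings of the natural numbers -/

/-- The colours among the first `p 0` ones that `tail p` takes on the first `t` codes of rationals
in the interval with the codes `I.1` and `I.2` of its end points. -/
def coloursSeen (p : ℕ → ℕ) (I : ℕ × ℕ) (t : ℕ) : Finset ℕ :=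
  {k ∈ Finset.range (p 0) | ∃ x < t,
    (ratOfCode I.1 < ratOfCode x ∧ ratOfCode x < ratOfCode I.2) ∧ tail p x = k}

/-- The subinterval of `I` coded by `a`. Every subinterval has infinitely many codes, and the codes
of intervals that are not subintervals of `I` are taken as codes of `I` itself. -/
def subinterval (I : ℕ × ℕ) (a : ℕ) : ℕ × ℕ :=
  if ratOfCode I.1 ≤ ratOfCode a.unpair.1.unpair.1 ∧
      ratOfCode a.unpair.1.unpair.1 < ratOfCode a.unpair.1.unpair.2 ∧
      ratOfCode a.unpair.1.unpair.2 ≤ ratOfCode I.2 then a.unpair.1.unpair else I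

/-- The nested intervals, starting from `]0, 1[`, that are given by a sequence of codes. -/
def nestedInterval (l : ℕ → ℕ) (k : ℕ) : ℕ × ℕ :=
  Nat.rec (0, Nat.pair (Nat.pair 1 0) 0) (fun k I => subinterval I (l k)) k

/-- The codes of the intervals that are tried at time `t`. The `k`-th interval is abandoned if at
least `p 0 - k` colours are seen in it. -/
def trialCodes (p : ℕ → ℕ) (t : ℕ) : List ℕ :=
  Nat.rec [] (fun t l => (List.range (p 0)).map fun k =>
    if p 0 - k ≤ (coloursSeen p (nestedInterval (fun j => l.getD j 0) (k + 1)) t).card then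
      l.getD k 0 + 1 else l.getD k 0) t

/-- The code of the `k`-th interval that is tried at time `t`. -/
def trialCode (p : ℕ → ℕ) (t k : ℕ) : ℕ := (trialCodes p t).getD k 0

/-- The first `k` intervals that are tried at time `t` lead to this interval. -/
def trialInterval (p : ℕ → ℕ) (t k : ℕ) : ℕ × ℕ := nestedInterval (trialCode p t) k

/-- The `k`-th interval is abandoned at time `t`. -/
def Abandoned (p : ℕ → ℕ) (k t : ℕ) : Prop :=
  p 0 - k ≤ (coloursSeen p (trialInterval p t (k + 1)) t).card

instance (p : ℕ → ℕ) (k t : ℕ) : Decidable (Abandoned p k t) :=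
  inferInstanceAs (Decidable (_ ≤ _))

theorem trialCode_succ {p : ℕ → ℕ} {t k : ℕ} (hk : k < p 0) : trialCode p (t + 1) k =
    if Abandoned p k t then trialCode p t k + 1 else trialCode p t k := by
  conv_lhs => rw [trialCode, trialCodes]
  rw [List.getD_eq_getElem _ _ (by simpa using hk), List.getElem_map, List.getElem_range]
  rfl

theorem subinterval_spec (I : ℕ × ℕ) (a : ℕ) (hI : ratOfCode I.1 < ratOfCode I.2) :
    ratOfCode I.1 ≤ ratOfCode (subinterval I a).1 ∧
    ratOfCode (subinterval I a).1 < ratOfCode (subinterval I a).2 ∧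
    ratOfCode (subinterval I a).2 ≤ ratOfCode I.2 := by
  unfold subinterval
  split_ifs with h
  · exact h
  · exact ⟨le_rfl, hI, le_rfl⟩

theorem nestedInterval_lt (l : ℕ → ℕ) (k : ℕ) :
    ratOfCode (nestedInterval l k).1 < ratOfCode (nestedInterval l k).2 := by
  induction k with
  | zero => simp [nestedInterval, ratOfCode]
  | succ k ih => exact (subinterval_spec _ _ ih).2.1

theorem nestedInterval_subset (l : ℕ → ℕ) {k m : ℕ} (h : k ≤ m) :
    ratOfCode (nestedInterval l k).1 ≤ ratOfCode (nestedInterval l m).1 ∧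
    ratOfCode (nestedInterval l m).2 ≤ ratOfCode (nestedInterval l k).2 := by
  induction m, h using Nat.le_induction with
  | base => exact ⟨le_rfl, le_rfl⟩
  | succ m _ ih =>
    have := subinterval_spec _ (l m) (nestedInterval_lt l m)
    exact ⟨ih.1.trans this.1, this.2.2.trans ih.2⟩

theorem nestedInterval_congr {l l' : ℕ → ℕ} {k : ℕ} (h : ∀ j < k, l j = l' j) :
    nestedInterval l k = nestedInterval l' k := by
  induction k with
  | zero => rfl
  | succ k ih =>
    change subinterval _ _ = subinterval _ _
    rw [h k (Nat.lt_succ_self k)]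
    exact congrArg (subinterval · _) (ih fun j hj => h j (hj.trans (Nat.lt_succ_self k)))

open Classical in
/-- The colours among the first `n` ones that `c` takes between `u` and `v`. -/
noncomputable def coloursOn (n : ℕ) (c : ℚ → ℕ) (u v : ℚ) : Finset ℕ :=
  {k ∈ Finset.range n | ∃ x, u < x ∧ x < v ∧ c x = k}

theorem mem_coloursOn {n : ℕ} {c : ℚ → ℕ} (hc : ∀ x, c x < n) {u v : ℚ} {k : ℕ} :
    k ∈ coloursOn n c u v ↔ ∃ x, u < x ∧ x < v ∧ c x = k := by
  simp only [coloursOn, Finset.mem_filter, Finset.mem_range, and_iff_right_iff_imp]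
  rintro ⟨x, -, -, rfl⟩
  exact hc x

theorem coloursSeen_subset {p : ℕ → ℕ} {c : ℚ → ℕ} (hp : NamesColouring p c) (I : ℕ × ℕ) (t : ℕ) :
    coloursSeen p I t ⊆ coloursOn (p 0) c (ratOfCode I.1) (ratOfCode I.2) := by
  intro k hk
  obtain ⟨-, x, -, hx, rfl⟩ := Finset.mem_filter.1 hk
  exact (mem_coloursOn hp.1).2 ⟨_, hx.1, hx.2, (hp.2 x).symm⟩

/-- Finitely many colours need only finitely many witnesses; the sum of their codes exceeds all of
them. -/
theorem exists_coloursOn_subset {p : ℕ → ℕ} {c : ℚ → ℕ} (hp : NamesColouring p c) (I : ℕ × ℕ)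
    (b : ℕ) : ∃ t > b, coloursOn (p 0) c (ratOfCode I.1) (ratOfCode I.2) ⊆ coloursSeen p I t := by
  have h : ∀ k ∈ coloursOn (p 0) c (ratOfCode I.1) (ratOfCode I.2), ∃ i,
      (ratOfCode I.1 < ratOfCode i ∧ ratOfCode i < ratOfCode I.2) ∧ tail p i = k := by
    intro k hk
    obtain ⟨x, hu, hv, rfl⟩ := (mem_coloursOn hp.1).1 hk
    obtain ⟨i, rfl⟩ := ratOfCode_surjective x
    exact ⟨i, ⟨hu, hv⟩, hp.2 i⟩
  choose! i hi hi' using h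
  refine ⟨b + 1 + ∑ k ∈ coloursOn (p 0) c (ratOfCode I.1) (ratOfCode I.2), (i k + 1), by omega,
    fun k hk => ?_⟩
  have : i k + 1 ≤ ∑ k ∈ coloursOn (p 0) c (ratOfCode I.1) (ratOfCode I.2), (i k + 1) :=
    Finset.single_le_sum (f := fun k => i k + 1) (fun _ _ => Nat.zero_le _) hk
  rw [coloursSeen, Finset.mem_filter]
  exact ⟨Finset.mem_range.2 (by rw [← hi' k hk, hp.2]; exact hp.1 _), i k, by omega, hi k hk, hi' k hk⟩

/-- Codes of later stages are not reset when an earlier interval changes. This is harmless, since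
every subinterval has arbitrarily large codes and a code that moves forever still meets each of
them. -/
theorem isShuffle_trialInterval {p : ℕ → ℕ} {c : ℚ → ℕ} (hp : NamesColouring p c) {b : ℕ}
    (hb : IsBound (eventColouring (p 0 - 1) (Abandoned p)) b) :
    IsShuffle c (ratOfCode (trialInterval p (b + 1) (p 0 - 1)).1)
      (ratOfCode (trialInterval p (b + 1) (p 0 - 1)).2) := by
  classical
  have hpos : 0 < p 0 := (Nat.zero_le _).trans_lt (hp.1 0)
  have hstay : ∀ {k}, k < p 0 → ∀ t, ¬ Abandoned p k t → trialCode p (t + 1) k = trialCode p t k :=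
    fun hk t h => by rw [trialCode_succ hk, if_neg h]
  have hmove : ∀ {k}, k < p 0 → ∀ t, Abandoned p k t →
      trialCode p (t + 1) k = trialCode p t k + 1 :=
    fun hk t h => by rw [trialCode_succ hk, if_pos h]
  -- `K` is the first stage that never settles, or the last index `p 0 - 1`; all stages before it
  -- are settled after `b`.
  have hex : ∃ k, k = p 0 - 1 ∨ ∀ N, ∃ t > N, Abandoned p k t := ⟨p 0 - 1, .inl rfl⟩
  set K := Nat.find hex with hK
  have hKle : K ≤ p 0 - 1 := Nat.find_min' hex (.inl rfl)
  have hbelow : ∀ k < K, ∀ t > b, ¬ Abandoned p k t := fun k hk =>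
    (event_dichotomy hb (hk.trans_le hKle)).resolve_right fun h => Nat.find_min hex hk (.inr h)
  set V := trialInterval p (b + 1) K with hV
  have hconst : ∀ t > b, trialInterval p t K = V := fun t ht => nestedInterval_congr fun k hk =>
    counter_eq (a := fun t => trialCode p t k) (hstay (by omega)) (hbelow k hk) ht
  -- Stage `K - 1` is not abandoned after `b`, so fewer than `p 0 - (K - 1)` colours are ever seen
  -- in `V`.
  have hupper : (coloursOn (p 0) c (ratOfCode V.1) (ratOfCode V.2)).card ≤ p 0 - K := by
    rcases Nat.eq_zero_or_pos K with h0 | h0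
    · rw [h0]
      exact (Finset.card_filter_le _ _).trans (Finset.card_range _).le
    · obtain ⟨t, ht, hsub⟩ := exists_coloursOn_subset hp V b
      have hna := hbelow (K - 1) (by omega) t ht
      rw [Abandoned, Nat.sub_add_cancel h0, hconst t ht] at hna
      have := Finset.card_le_card hsub
      omega
  -- For `K = p 0 - 1` a single colour suffices. Otherwise stage `K` tries the subinterval at some
  -- time after `b` and abandons it, having seen enough colours.
  have hlower : ∀ x y, ratOfCode V.1 ≤ x → x < y → y ≤ ratOfCode V.2 →
      p 0 - K ≤ (coloursOn (p 0) c x y).card := by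
    intro x y hx hxy hy
    rcases Nat.find_spec hex with h | h
    · obtain ⟨z, hxz, hzy⟩ := exists_between hxy
      have : 0 < (coloursOn (p 0) c x y).card :=
        Finset.card_pos.2 ⟨c z, (mem_coloursOn hp.1).2 ⟨z, hxz, hzy, rfl⟩⟩
      rw [← hK] at h
      omega
    · obtain ⟨i, rfl⟩ := ratOfCode_surjective x
      obtain ⟨j, rfl⟩ := ratOfCode_surjective y
      have hKlt : K < p 0 := by omega
      -- Time is shifted by `b + 1`, so that stage `K` chooses subintervals of the settled `V`. The
      -- second component of the code `v` is padding that makes it at least the current code.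
      obtain ⟨t, ht, hE⟩ := counter_surjective (a := fun t => trialCode p (t + (b + 1)) K)
        (E := fun t => Abandoned p K (t + (b + 1)))
        (fun t ht => by rw [add_right_comm]; exact hstay hKlt _ ht)
        (fun t ht => by rw [add_right_comm]; exact hmove hKlt _ ht)
        (fun N => by
          obtain ⟨t, ht, h'⟩ := h (N + (b + 1))
          exact ⟨t - (b + 1), by omega, by rwa [Nat.sub_add_cancel (by omega)]⟩)
        (v := Nat.pair (Nat.pair i j) (trialCode p (0 + (b + 1)) K)) (Nat.right_le_pair _ _)
      have hI : trialInterval p (t + (b + 1)) (K + 1) = (i, j) := by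
        change subinterval (trialInterval p (t + (b + 1)) K) _ = _
        rw [hconst _ (by omega), ht]
        simp [subinterval, hx, hxy, hy]
      rw [Abandoned, hI] at hE
      exact hE.trans (Finset.card_le_card (coloursSeen_subset hp _ _))
  have hsub := nestedInterval_subset (trialCode p (b + 1)) hKle
  refine .of_exists_between hp.1 fun x hx y hy z hz hxy => ?_
  have hVx : ratOfCode V.1 ≤ x := hsub.1.trans hx.1.le
  have hVy : y ≤ ratOfCode V.2 := hy.2.le.trans hsub.2
  have hle : coloursOn (p 0) c x y ⊆ coloursOn (p 0) c (ratOfCode V.1) (ratOfCode V.2) := by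
    intro k hk
    obtain ⟨w, hxw, hwy, h⟩ := (mem_coloursOn hp.1).1 hk
    exact (mem_coloursOn hp.1).2 ⟨w, hVx.trans_lt hxw, hwy.trans_le hVy, h⟩
  -- Upper and lower bound agree, so each subinterval of `V` has all the colours of `V`; this passes
  -- to the innermost interval.
  have heq := Finset.eq_of_subset_of_card_le hle (hupper.trans (hlower x y hVx hxy hVy))
  exact (mem_coloursOn hp.1).1 (heq ▸ (mem_coloursOn hp.1).2
    ⟨z, hsub.1.trans_lt hz.1, hz.2.trans_le hsub.2, rfl⟩)

/-! ### Computability of the interval search. -/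

namespace OracleComputable

variable {α : Type*} [Primcodable α]

theorem card_coloursSeen {I : (ℕ → ℕ) → α → ℕ × ℕ} {f : (ℕ → ℕ) → α → ℕ}
    (hI : OracleComputable I) (hf : OracleComputable f) :
    OracleComputable fun p a => (coloursSeen p (I p a) (f p a)).card := by
  simp only [coloursSeen, Finset.card_filter]
  exact sum_range (g := fun p (a : α × ℕ) => if ∃ x < f p a.1,
      (ratOfCode (I p a.1).1 < ratOfCode x ∧ ratOfCode x < ratOfCode (I p a.1).2) ∧
        Weihrauch.tail p x = a.2 then 1 else 0) (head id.apply)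
    (ite (dec_exists_lt (c := fun p (a : (α × ℕ) × ℕ) =>
        (ratOfCode (I p a.1.1).1 < ratOfCode a.2 ∧ ratOfCode a.2 < ratOfCode (I p a.1.1).2) ∧
          Weihrauch.tail p a.2 = a.1.2) (hf.comp fst)
      (dec_and (dec_and (dec_ratOfCode_lt (fst.comp (hI.comp (fst.comp fst))) snd)
          (dec_ratOfCode_lt snd (snd.comp (hI.comp (fst.comp fst)))))
        (dec_eq ((tail id.apply).comp snd) (snd.comp fst)))) (const 1) (const 0))

theorem subinterval {I : (ℕ → ℕ) → α → ℕ × ℕ} {f : (ℕ → ℕ) → α → ℕ}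
    (hI : OracleComputable I) (hf : OracleComputable f) :
    OracleComputable fun p a => subinterval (I p a) (f p a) := by
  have h₁ := unpair_fst (unpair_fst hf)
  have h₂ := unpair_snd (unpair_fst hf)
  exact ite (dec_and (dec_ratOfCode_le (fst.comp hI) h₁)
    (dec_and (dec_ratOfCode_lt h₁ h₂) (dec_ratOfCode_le h₂ (snd.comp hI))))
    (map .unpair (unpair_fst hf)) hI

theorem nestedInterval {l : (ℕ → ℕ) → α → List ℕ} {f : (ℕ → ℕ) → α → ℕ}
    (hl : OracleComputable l) (hf : OracleComputable f) :
    OracleComputable fun p a => nestedInterval (fun j => (l p a).getD j 0) (f p a) :=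
  nat_rec (h := fun p (y : α × ℕ × (ℕ × ℕ)) =>
    Weihrauch.subinterval y.2.2 ((l p y.1).getD y.2.1 0)) hf (const _)
    (subinterval (snd.comp snd) (getD 0 (hl.comp fst) (fst.comp snd)))

theorem trialCodes {f : (ℕ → ℕ) → α → ℕ} (hf : OracleComputable f) :
    OracleComputable fun p a => trialCodes p (f p a) := by
  have hl : OracleComputable fun _ (z : (α × ℕ × List ℕ) × ℕ) => z.1.2.2 :=
    snd.comp (snd.comp fst)
  exact nat_rec (h := fun p (y : α × ℕ × List ℕ) => (List.range (p 0)).map fun k =>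
    if p 0 - k ≤ (coloursSeen p
      (Weihrauch.nestedInterval (fun j => y.2.2.getD j 0) (k + 1)) y.2.1).card then
      y.2.2.getD k 0 + 1 else y.2.2.getD k 0) hf (const [])
    (map_range (g := fun p (z : (α × ℕ × List ℕ) × ℕ) =>
      if p 0 - z.2 ≤ (coloursSeen p
        (Weihrauch.nestedInterval (fun j => z.1.2.2.getD j 0) (z.2 + 1)) z.1.2.1).card then
        z.1.2.2.getD z.2 0 + 1 else z.1.2.2.getD z.2 0) (head id.apply)
      (ite (dec_le (sub (head id.apply) snd)
          (card_coloursSeen (nestedInterval hl (add snd (const 1))) (fst.comp (snd.comp fst))))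
        (add (getD 0 hl snd) (const 1)) (getD 0 hl snd)))

theorem trialInterval {f g : (ℕ → ℕ) → α → ℕ} (hf : OracleComputable f)
    (hg : OracleComputable g) : OracleComputable fun p a => trialInterval p (f p a) (g p a) :=
  nestedInterval (trialCodes hf) hg

theorem dec_abandoned {f g : (ℕ → ℕ) → α → ℕ} (hf : OracleComputable f)
    (hg : OracleComputable g) : OracleComputable fun p a => decide (Abandoned p (f p a) (g p a)) :=
  dec_le (sub (head id.apply) hf)
    (card_coloursSeen (trialInterval hg (add hf (const 1))) hg)

end OracleComputable

theorem iShuffle_totallyReducible_ECT : TotallyReducible iShuffle ECT ∧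
    ∀ n, TotallyReducible (iShuffle.withFirst n) (ECT.withFirst n) := by
  refine TotallyReducible.of_head_eq (fun p => cons (p 0) (eventColouring (p 0 - 1) (Abandoned p)))
    (fun s p x => if x = 0 then (trialInterval p (s 0 + 1) (p 0 - 1)).1
      else (trialInterval p (s 0 + 1) (p 0 - 1)).2)
    (.cons (.head (.apply .id)) (.eventColouring (.sub (.head (.apply .id)) (.const 1))
      (.dec_abandoned .fst .snd))) ?_ (fun _ => rfl) ?_
  · have h : OracleComputable fun r (_ : ℕ) =>
        trialInterval (odds r) (evens r 0 + 1) (odds r 0 - 1) := by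
      have h₁ : OracleComputable fun p (a : ℕ × ℕ) => trialInterval p a.1 a.2 :=
        .trialInterval .fst .snd
      have h₂ : OracleComputable fun r (_ : ℕ) => evens r 0 + 1 := .add (.head .evens) (.const 1)
      have h₃ : OracleComputable fun r (_ : ℕ) => odds r 0 - 1 := .sub (.head .odds) (.const 1)
      have h₄ : OracleComputable fun r (a : ℕ × ℕ) => trialInterval (odds r) a.1 a.2 :=
        OracleComputable.subst (f := fun p (a : ℕ × ℕ) => trialInterval p a.1 a.2) (x := odds)
          h₁ .odds
      exact OracleComputable.comp (f := fun r (a : ℕ × ℕ) => trialInterval (odds r) a.1 a.2)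
        (g := fun r (_ : ℕ) => (evens r 0 + 1, odds r 0 - 1)) h₄ (h₂.pair h₃)
    have h₁ : OracleComputable fun r (_ : ℕ) =>
        (trialInterval (odds r) (evens r 0 + 1) (odds r 0 - 1)).1 := OracleComputable.fst.comp h
    have h₂ : OracleComputable fun r (_ : ℕ) =>
        (trialInterval (odds r) (evens r 0 + 1) (odds r 0 - 1)).2 := OracleComputable.snd.comp h
    exact .ite (.dec_eq .id (.const 0)) h₁ h₂
  · rintro p ⟨c, hc⟩
    have hpos : 0 < p 0 := (Nat.zero_le _).trans_lt (hc.1 0)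
    refine ⟨fun x => ?_, fun s hs => ⟨?_, c, hc, ?_⟩⟩
    · have := eventColouring_lt (p 0 - 1) (Abandoned p) x
      rwa [Nat.sub_add_cancel hpos] at this
    · exact nestedInterval_lt _ _
    · exact isShuffle_trialInterval hc hs

end Weihrauch

theorem mainTheorem5 :
    (∀ n : ℕ, 1 ≤ n →
      Weihrauch.Equivalent (Weihrauch.ECT.withFirst n) (Weihrauch.iShuffle.withFirst n) ∧
      Weihrauch.Equivalent (Weihrauch.iShuffle.withFirst n) (Weihrauch.TCN.power (n - 1))) ∧
    Weihrauch.Equivalent Weihrauch.ECT Weihrauch.iShuffle ∧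
    Weihrauch.Equivalent Weihrauch.iShuffle Weihrauch.TCN.finPar := by
  obtain ⟨h₁, h₁'⟩ := Weihrauch.ECT_totallyReducible_iShuffle
  obtain ⟨h₂, h₂'⟩ := Weihrauch.iShuffle_totallyReducible_ECT
  refine ⟨fun n hn => ⟨⟨(h₁' n).reducible, (h₂' n).reducible⟩,
    ((h₂' n).trans (Weihrauch.ECT_withFirst_totallyReducible_power n)).reducible, ?_⟩,
    ⟨h₁.reducible, h₂.reducible⟩, (h₂.trans Weihrauch.ECT_totallyReducible_finPar).reducible,
    (Weihrauch.finPar_totallyReducible_ECT.trans h₁).reducible⟩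
  -- Only this direction needs `1 ≤ n`: for `n = 0` the colouring problem has no instance, while the
  -- empty power does.
  obtain ⟨m, rfl⟩ : ∃ m, n = m + 1 := ⟨n - 1, by omega⟩
  exact ((Weihrauch.power_totallyReducible_ECT_withFirst m).trans (h₁' (m + 1))).reducible
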